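/- Let $G=(N,E)$ be a finite simple undirected graph with $|E|\ge 1$, not necessarily connected. For $k\ge 1$, an interleaved $k$-tuple coloring of $G$ assigns to each node $i$ a set of $k$ distinct natural numbers (colors) $c_i^1<\cdots<c_i^k$ such that for every edge $(i,j)\in E$ either $c_i^1<c_j^1<c_i^2<c_j^2<\cdots<c_i^k<c_j^k$ or $c_j^1<c_i^1<c_j^2<c_i^2<\cdots<c_j^k<c_i^k$. Let $\chi_{\rm int}^k(G)$ be the least total number of distinct colors used by such a coloring, and let $\chi_{\rm int}^*(G)=\inf_{k\ge 1}\chi_{\rm int}^k(G)/k$ be the interleaved multichromatic number of $G$. If $G$ is a forest, then $\chi_{\rm int}^*(G)=2$. Otherwise, $$\chi_{\rm int}^*(G)=\min_{\omega\in\Omega(G)}\ \max_{\kappa\in K}\ \frac{|\kappa|}{\min\{m(\kappa^+,\omega),\,m(\kappa^-,\omega)\}},$$ where $\Omega(G)$ is the set of all acyclic orientations of $G$ (assignments of a direction to each edge that form no directed cycle), $K$ is the set of all simple cycles of $G$, $|\kappa|$ is the number of edges of $\kappa$, $\kappa^+$ and $\kappa^-$ are the two traversal directions of $\kappa$, and $m(\kappa^\pm,\omega)$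 is the number of edges of $\kappa$ that $\omega$ orients in the direction $\kappa^\pm$. Both the minimum and the maximum are attained. -/

import Mathlib

namespace InterleavedColoring

variable {V : Type*}

/-- `c v` lists, in increasing order, the `k` distinct colors of the node `v`;
adjacent nodes never share a color. -/
structure IsTupleColoring (G : SimpleGraph V) (k : ℕ) (c : V → Fin k → ℕ) : Prop where
  strictMono : ∀ v, StrictMono (c v)
  disjoint : ∀ i j, G.Adj i j → ∀ a b, c i a ≠ c j b

/-- `x₁ < y₁ < x₂ < y₂ < ⋯ < x_k < y_k`. -/
def Alternates {k : ℕ} (x y : Fin k → ℕ) : Prop :=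
  (∀ a, x a < y a) ∧ ∀ a b : Fin k, a.val + 1 = b.val → y a < x b

/-- An interleaved `k`-tuple coloring. -/
structure IsInterleaved (G : SimpleGraph V) (k : ℕ) (c : V → Fin k → ℕ) : Prop
    extends IsTupleColoring G k c where
  alternates : ∀ i j, G.Adj i j → Alternates (c i) (c j) ∨ Alternates (c j) (c i)

/-- The total number of distinct colors in use. -/
noncomputable def numColors {k : ℕ} (c : V → Fin k → ℕ) : ℕ :=
  (⋃ v, Set.range (c v)).ncard

/-- The interleaved `k`-chromatic number (of a finite graph). -/
noncomputable def chiInt (G : SimpleGraph V) (k : ℕ) : ℕ :=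
  sInf {n | ∃ c : V → Fin k → ℕ, IsInterleaved G k c ∧ numColors c = n}

/-- The interleaved multichromatic number (of a finite graph), an infimum over `k ≥ 1`. -/
noncomputable def chiIntStar (G : SimpleGraph V) : ℝ :=
  ⨅ k : ℕ+, (chiInt G k : ℝ) / ((k : ℕ) : ℝ)

/-- An acyclic orientation: every edge gets exactly one of its two directions
(`dir i j` means that it is directed from `i` to `j`), and no directed cycle is formed. -/
structure AcyclicOrientation (G : SimpleGraph V) where
  dir : V → V → Prop
  adj_of_dir : ∀ i j, dir i j → G.Adj i j
  dir_or_dir : ∀ i j, G.Adj i j → dir i j ∨ dir j i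
  asymm : ∀ i j, dir i j → ¬ dir j i
  acyclic : ∀ i, ¬ Relation.TransGen dir i i

open Classical in
/-- The number of steps of the walk `p` that agree with the orientation `ω`. For a simple cycle
`κ` traversed in one direction, the other traversal direction is `κ.reverse`. -/
noncomputable def agree {G : SimpleGraph V} (ω : AcyclicOrientation G) {u v : V}
    (p : G.Walk u v) : ℕ :=
  p.darts.countP (fun d => decide (ω.dir d.fst d.snd))

/-- The ratio `|κ| / min {m(κ⁺, ω), m(κ⁻, ω)}`. -/
noncomputable def cycleRatio {G : SimpleGraph V} (ω : AcyclicOrientation G) {v : V}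
    (κ : G.Walk v v) : ℝ :=
  (κ.length : ℝ) / ((min (agree ω κ) (agree ω κ.reverse) : ℕ) : ℝ)

/-- The set of the ratios of all simple cycles of `G` under `ω`. -/
def cycleRatios {G : SimpleGraph V} (ω : AcyclicOrientation G) : Set ℝ :=
  {r | ∃ (v : V) (κ : G.Walk v v), κ.IsCycle ∧ r = cycleRatio ω κ}

/-- The largest ratio of a simple cycle of `G` under `ω`. -/
noncomputable def maxCycleRatio {G : SimpleGraph V} (ω : AcyclicOrientation G) : ℝ :=
  sSup (cycleRatios ω)

end InterleavedColoring

/-! Both quantities are compared through real potentials `T` whose increase along each edge, in one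
direction, lies in `[1, r - 1]` (`IsTension`). A coloring by `k`-tuples with `n` colors gives one
with `r = n / k`, by averaging ranks of colors (`IsInterleaved.exists_isTension`). Conversely, the
colors `⌊T i + r a⌋` use at most `r k + O(1)` values, so `chiIntStar G ≤ r` as `k` grows
(`IsTension.chiIntStar_le`). For a fixed orientation and `r ≥ 2`, these are difference constraints,
solvable exactly when no cycle has positive gain, a forward step counting `1` and a backward step `1
- r`; that is, when every cycle ratio is at most `r` (`exists_isTension`,
`IsTension.cycleRatio_le`). In a forest only `r ≥ 2` remains. -/

namespace InterleavedColoring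

/-! ### Cycle ratios of an acyclic orientation -/

section Walks

variable {V : Type*} {G : SimpleGraph V} (ω : AcyclicOrientation G)

@[simp]
theorem agree_nil (u : V) : agree ω (SimpleGraph.Walk.nil : G.Walk u u) = 0 := by
  simp [agree]

theorem agree_append {u v w : V} (p : G.Walk u v) (q : G.Walk v w) :
    agree ω (p.append q) = agree ω p + agree ω q := by
  simp [agree, SimpleGraph.Walk.darts_append]

theorem agree_cons_of_dir {u v w : V} (h : G.Adj u v) (p : G.Walk v w) (hd : ω.dir u v) :
    agree ω (SimpleGraph.Walk.cons h p) = agree ω p + 1 := by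
  simp [agree, hd]

theorem agree_cons_of_not_dir {u v w : V} (h : G.Adj u v) (p : G.Walk v w) (hd : ¬ ω.dir u v) :
    agree ω (SimpleGraph.Walk.cons h p) = agree ω p := by
  simp [agree, hd]

theorem agree_add_agree_reverse {u v : V} (p : G.Walk u v) :
    agree ω p + agree ω p.reverse = p.length := by
  induction p with
  | nil => simp
  | @cons u v w h p ih =>
    rw [SimpleGraph.Walk.reverse_cons, agree_append, SimpleGraph.Walk.length_cons]
    by_cases hd : ω.dir u v
    · rw [agree_cons_of_dir ω h p hd,
        agree_cons_of_not_dir ω h.symm .nil (ω.asymm _ _ hd), agree_nil]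
      omega
    · rw [agree_cons_of_not_dir ω h p hd,
        agree_cons_of_dir ω h.symm .nil ((ω.dir_or_dir _ _ h).resolve_left hd), agree_nil]
      omega

theorem reflTransGen_of_agree_eq_length {u v : V} (p : G.Walk u v) (hp : agree ω p = p.length) :
    Relation.ReflTransGen ω.dir u v := by
  induction p with
  | nil => exact .refl
  | @cons u v w h p ih =>
    have hle := agree_add_agree_reverse ω p
    rw [SimpleGraph.Walk.length_cons] at hp
    by_cases hd : ω.dir u v
    · rw [agree_cons_of_dir ω h p hd] at hp
      exact .head hd (ih (by omega))
    · rw [agree_cons_of_not_dir ω h p hd] at hp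
      omega

theorem agree_lt_length {v : V} (κ : G.Walk v v) (hκ : 0 < κ.length) :
    agree ω κ < κ.length := by
  have hle := agree_add_agree_reverse ω κ
  refine lt_of_le_of_ne (by omega) fun heq => ?_
  cases κ with
  | nil => simp at hκ
  | @cons _ w _ h p =>
    have hle := agree_add_agree_reverse ω p
    rw [SimpleGraph.Walk.length_cons] at heq
    by_cases hd : ω.dir v w
    · rw [agree_cons_of_dir ω h p hd] at heq
      exact ω.acyclic v (.head' hd (reflTransGen_of_agree_eq_length ω p (by omega)))
    · rw [agree_cons_of_not_dir ω h p hd] at heq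
      omega

/-- A cycle with no step against one of its traversals would be directed. Hence no ratio has
denominator zero. -/
theorem min_agree_pos {v : V} {κ : G.Walk v v} (hκ : κ.IsCycle) :
    0 < min (agree ω κ) (agree ω κ.reverse) := by
  have h3 := hκ.three_le_length
  have h1 := agree_lt_length ω κ (by omega)
  have h2 := agree_lt_length ω κ.reverse (by simp; omega)
  rw [SimpleGraph.Walk.length_reverse] at h2
  have := agree_add_agree_reverse ω κ
  exact lt_min (by omega) (by omega)

theorem two_le_cycleRatio {v : V} {κ : G.Walk v v} (hκ : κ.IsCycle) : 2 ≤ cycleRatio ω κ := by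
  have h := agree_add_agree_reverse ω κ
  have hpos := min_agree_pos ω hκ
  rw [cycleRatio, le_div_iff₀ (by exact_mod_cast hpos)]
  have : 2 * min (agree ω κ) (agree ω κ.reverse) ≤ κ.length := by omega
  exact_mod_cast this

theorem length_le_mul_agree_of_cycleRatio_le {r : ℝ} {v : V} {κ : G.Walk v v} (hκ : κ.IsCycle)
    (h : cycleRatio ω κ ≤ r) : (κ.length : ℝ) ≤ r * agree ω κ.reverse := by
  have hpos := min_agree_pos ω hκ
  have hr : 0 ≤ r := by linarith [two_le_cycleRatio ω hκ]
  rw [cycleRatio, div_le_iff₀ (by exact_mod_cast hpos)] at h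
  refine h.trans (mul_le_mul_of_nonneg_left ?_ hr)
  exact_mod_cast min_le_right _ _

theorem cycleRatio_le_of_length_le_mul {r : ℝ} {v : V} {κ : G.Walk v v} (hκ : κ.IsCycle)
    (h : (κ.length : ℝ) ≤ r * agree ω κ) (h' : (κ.length : ℝ) ≤ r * agree ω κ.reverse) :
    cycleRatio ω κ ≤ r := by
  have hpos := min_agree_pos ω hκ
  rw [cycleRatio, div_le_iff₀ (by exact_mod_cast hpos)]
  rcases min_choice (agree ω κ) (agree ω κ.reverse) with h0 | h0 <;> rw [h0] <;> assumption

theorem isCycle_length_le_card [Finite V] {v : V} {κ : G.Walk v v} (hκ : κ.IsCycle) :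
    κ.length ≤ Nat.card V := by
  have := Fintype.ofFinite V
  have h := hκ.support_nodup.length_le_card
  rw [Nat.card_eq_fintype_card]
  simpa using h

theorem finite_cycleRatios [Finite V] : (cycleRatios ω).Finite := by
  refine (((Set.finite_Iic (Nat.card V)).prod (Set.finite_Iic (Nat.card V))).image
    fun x : ℕ × ℕ => (x.1 : ℝ) / (x.2 : ℝ)).subset ?_
  rintro r ⟨v, κ, hκ, rfl⟩
  have h1 := isCycle_length_le_card hκ
  have h2 := agree_add_agree_reverse ω κ
  exact ⟨(κ.length, min (agree ω κ) (agree ω κ.reverse)),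
    ⟨h1, by simp only [Set.mem_Iic]; omega⟩, rfl⟩

theorem isGreatest_maxCycleRatio [Finite V] (hG : ¬ G.IsAcyclic) :
    IsGreatest (cycleRatios ω) (maxCycleRatio ω) := by
  have hne : (cycleRatios ω).Nonempty := by
    simp only [SimpleGraph.IsAcyclic, not_forall, not_not] at hG
    obtain ⟨v, κ, hκ⟩ := hG
    exact ⟨_, v, κ, hκ, rfl⟩
  exact ⟨hne.csSup_mem (finite_cycleRatios ω),
    fun _ h => le_csSup (finite_cycleRatios ω).bddAbove h⟩

instance [Finite V] : Finite (AcyclicOrientation G) :=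
  Finite.of_injective (AcyclicOrientation.dir (G := G)) fun ω₁ ω₂ h => by
    cases ω₁; cases ω₂; cases h; rfl

end Walks

/-! ### Potentials and their cycle conditions -/

section Tensions

variable {V : Type*} {G : SimpleGraph V}

/-- Along every edge, in one of its directions, `T` increases by an amount in `[1, r - 1]`. -/
def IsTension (G : SimpleGraph V) (r : ℝ) (T : V → ℝ) : Prop :=
  ∀ i j, G.Adj i j → (T i + 1 ≤ T j ∧ T j + 1 ≤ T i + r) ∨ (T j + 1 ≤ T i ∧ T i + 1 ≤ T j + r)

/-- The orientation of every edge towards the larger value of `T`. -/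
def IsTension.orientation {r : ℝ} {T : V → ℝ} (hT : IsTension G r T) : AcyclicOrientation G where
  dir i j := G.Adj i j ∧ T i < T j
  adj_of_dir _ _ h := h.1
  dir_or_dir i j h := by
    rcases hT i j h with h' | h'
    · exact .inl ⟨h, by linarith⟩
    · exact .inr ⟨h.symm, by linarith⟩
  asymm _ _ h h' := lt_asymm h.2 h'.2
  acyclic i h := by
    have key : ∀ j, Relation.TransGen (fun i j => G.Adj i j ∧ T i < T j) i j → T i < T j := by
      intro j hj
      induction hj with
      | single h => exact h.2
      | tail _ h ih => exact ih.trans h.2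
    exact lt_irrefl _ (key i h)

/-- A forward step raises `T` by at least `1`, a backward step by at least `1 - r`; on a closed walk
the right side vanishes. -/
theorem IsTension.length_le {r : ℝ} {T : V → ℝ} (hT : IsTension G r T) {u v : V}
    (p : G.Walk u v) : p.length - r * agree hT.orientation p.reverse ≤ T v - T u := by
  induction p with
  | nil => simp
  | @cons u v w h p ih =>
    rw [SimpleGraph.Walk.reverse_cons, agree_append, SimpleGraph.Walk.length_cons]
    by_cases hd : hT.orientation.dir u v
    · rw [agree_cons_of_not_dir _ h.symm .nil (hT.orientation.asymm _ _ hd), agree_nil]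
      have hlt : T u < T v := hd.2
      push_cast
      rcases hT u v h with h' | h' <;> linarith
    · have hd' := (hT.orientation.dir_or_dir _ _ h).resolve_left hd
      rw [agree_cons_of_dir _ h.symm .nil hd', agree_nil]
      have hlt : T v < T u := hd'.2
      push_cast
      rcases hT u v h with h' | h' <;> linarith

theorem IsTension.cycleRatio_le {r : ℝ} {T : V → ℝ} (hT : IsTension G r T) {v : V}
    {κ : G.Walk v v} (hκ : κ.IsCycle) : cycleRatio hT.orientation κ ≤ r := by
  have h1 := hT.length_le κ
  have h2 := hT.length_le κ.reverse
  rw [SimpleGraph.Walk.reverse_reverse, SimpleGraph.Walk.length_reverse] at h2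
  exact cycleRatio_le_of_length_le_mul _ hκ (by linarith) (by linarith)

/-- A potential given by longest paths. -/
theorem exists_isTension [Finite V] (ω : AcyclicOrientation G) {r : ℝ} (hr : 2 ≤ r)
    (hω : ∀ (v : V) (κ : G.Walk v v), κ.IsCycle → cycleRatio ω κ ≤ r) :
    ∃ T : V → ℝ, IsTension G r T := by
  classical
  let gain : ∀ {u v : V}, G.Walk u v → ℝ := fun p => p.length - r * agree ω p.reverse
  have gain_append {u v w : V} (p : G.Walk u v) (q : G.Walk v w) :
      gain (p.append q) = gain p + gain q := by
    simp only [gain, SimpleGraph.Walk.length_append, SimpleGraph.Walk.reverse_append,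
      agree_append]
    push_cast
    ring
  have gain_fwd {i j : V} (h : G.Adj i j) (hd : ω.dir i j) : gain h.toWalk = 1 := by
    have := agree_cons_of_not_dir ω h.symm .nil (ω.asymm _ _ hd)
    simp [gain, this]
  have gain_bwd {i j : V} (h : G.Adj i j) (hd : ω.dir j i) : gain h.toWalk = 1 - r := by
    have := agree_cons_of_dir ω h.symm .nil hd
    simp [gain, this]
  -- The closed walk is either a simple cycle or one edge there and back, of gain `2 - r`; the
  -- latter is why `2 ≤ r` is needed.
  have gain_cycle {i j : V} (h : G.Adj i j) (q : G.Walk j i) (hq : q.IsPath) :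
      gain q + gain h.toWalk ≤ 0 := by
    by_cases he : s(i, j) ∈ q.edges
    · rw [Sym2.eq_swap] at he
      rw [hq.eq_adj_toWalk_of_mem_edges he]
      rcases ω.dir_or_dir _ _ h with hd | hd
      · rw [gain_fwd h hd, gain_bwd h.symm hd]; linarith
      · rw [gain_bwd h hd, gain_fwd h.symm hd]; linarith
    · have hc : (SimpleGraph.Walk.cons h q).IsCycle :=
        (SimpleGraph.Walk.cons_isCycle_iff q h).2 ⟨hq, he⟩
      have hle := length_le_mul_agree_of_cycleRatio_le ω hc (hω _ _ hc)
      have hg : gain (SimpleGraph.Walk.cons h q) = gain h.toWalk + gain q :=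
        gain_append h.toWalk q
      have : gain (SimpleGraph.Walk.cons h q) ≤ 0 := by
        simp only [gain]; linarith
      linarith
  let gains : V → Set ℝ := fun j => {x | ∃ (i : V) (p : G.Walk i j), p.IsPath ∧ x = gain p}
  have hbdd (j : V) : BddAbove (gains j) := by
    have := Fintype.ofFinite V
    refine ⟨Fintype.card V, ?_⟩
    rintro _ ⟨i, p, hp, rfl⟩
    have h1 : (p.length : ℝ) ≤ Fintype.card V := by exact_mod_cast hp.length_lt.le
    have h2 : 0 ≤ r * agree ω p.reverse := by positivity
    simp only [gain]
    linarith
  have hstep {i j : V} (h : G.Adj i j) : sSup (gains i) ≤ sSup (gains j) - gain h.toWalk := by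
    refine csSup_le ⟨_, i, .nil, .nil, rfl⟩ ?_
    rintro _ ⟨u, p, hp, rfl⟩
    -- If appending `j` would break simplicity, the closed part from `j` back to `j` is cut off,
    -- which loses no gain.
    by_cases hj : j ∈ p.support
    · have h1 := gain_append (p.takeUntil j hj) (p.dropUntil j hj)
      rw [SimpleGraph.Walk.take_spec] at h1
      have h2 := gain_cycle h _ (hp.dropUntil hj)
      have h3 : gain (p.takeUntil j hj) ≤ sSup (gains j) :=
        le_csSup (hbdd j) ⟨u, _, hp.takeUntil hj, rfl⟩
      linarith
    · have h1 := gain_append p h.toWalk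
      have h3 : gain (p.append h.toWalk) ≤ sSup (gains j) :=
        le_csSup (hbdd j) ⟨u, _, hp.concat hj h, rfl⟩
      linarith
  refine ⟨fun j => sSup (gains j), fun i j h => ?_⟩
  have h1 := hstep h
  have h2 := hstep h.symm
  rcases ω.dir_or_dir _ _ h with hd | hd
  · rw [gain_fwd h hd] at h1
    rw [gain_bwd h.symm hd] at h2
    exact .inl ⟨by linarith, by linarith⟩
  · rw [gain_bwd h hd] at h1
    rw [gain_fwd h.symm hd] at h2
    exact .inr ⟨by linarith, by linarith⟩

/-- Any injective numbering works for large `r`. This supplies an acyclic orientation and keeps the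
infimum in `chiInt` from being over the empty set. -/
theorem exists_isTension_of_finite [Finite V] (G : SimpleGraph V) :
    ∃ (r : ℝ) (T : V → ℝ), 1 ≤ r ∧ IsTension G r T := by
  obtain ⟨n, ⟨e⟩⟩ := Finite.exists_equiv_fin V
  have key (i j : V) (h : (e i).val < (e j).val) :
      ((e i : ℕ) : ℝ) + 1 ≤ (e j : ℕ) ∧ ((e j : ℕ) : ℝ) + 1 ≤ (e i : ℕ) + (n + 1 : ℝ) := by
    refine ⟨by exact_mod_cast h, ?_⟩
    have : (e j : ℕ) + 1 ≤ (e i : ℕ) + (n + 1) := by have := (e j).isLt; omega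
    exact_mod_cast this
  refine ⟨n + 1, fun i => (e i : ℕ), by simp, fun i j h => ?_⟩
  have hne : (e i).val ≠ (e j).val := fun h' => h.ne (e.injective (Fin.ext h'))
  rcases hne.lt_or_gt with h' | h'
  · exact .inl (key i j h')
  · exact .inr (key j i h')

end Tensions

/-! ### Passing between potentials and colorings -/

section Colorings

variable {V : Type*} {G : SimpleGraph V}

theorem Alternates.ne {k : ℕ} {x y : Fin k → ℕ} (h : Alternates x y) (hx : StrictMono x)
    (a b : Fin k) : x a ≠ y b := by
  rcases le_or_gt a b with hab | hab
  · exact ((hx.monotone hab).trans_lt (h.1 b)).ne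
  · have hlt : b.val < a.val := hab
    let b' : Fin k := ⟨b.val + 1, by omega⟩
    have hb' : b' ≤ a := Fin.mk_le_of_le_val hlt
    exact ((h.2 b b' rfl).trans_le (hx.monotone hb')).ne'

/-- A gap of at least `1` survives the floor; nonnegativity matters because the natural floor
truncates at `0`. -/
theorem alternates_floor {k : ℕ} {r s t : ℝ} (h1 : s + 1 ≤ t) (h2 : t + 1 ≤ s + r)
    (hr : 0 ≤ r) (hs : 0 ≤ s) :
    Alternates (fun a : Fin k => ⌊s + r * (a : ℕ)⌋₊) (fun a : Fin k => ⌊t + r * (a : ℕ)⌋₊) := by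
  have key {x y : ℝ} (hx : 0 ≤ x) (h : x + 1 ≤ y) : ⌊x⌋₊ < ⌊y⌋₊ := by
    have := Nat.floor_mono h
    rw [Nat.floor_add_one hx] at this
    exact this
  refine ⟨fun a => key (by positivity) (by linarith), fun a b hab => key ?_ ?_⟩
  · have : 0 ≤ t := by linarith
    positivity
  · rw [← hab]
    push_cast
    linarith

/-- The coloring whose `a`-th color at `i` is `⌊T i + r a⌋`. -/
theorem IsTension.isInterleaved {r : ℝ} {T : V → ℝ} (hT : IsTension G r T) (hr : 1 ≤ r)
    (h0 : ∀ i, 0 ≤ T i) (k : ℕ) :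
    IsInterleaved G k (fun i a => ⌊T i + r * (a : ℕ)⌋₊) := by
  have hmono (i : V) : StrictMono (fun a : Fin k => ⌊T i + r * (a : ℕ)⌋₊) := by
    intro a b hab
    have hab' : ((a : ℕ) : ℝ) + 1 ≤ (b : ℕ) := by exact_mod_cast hab
    have h1 : T i + r * (a : ℕ) + 1 ≤ T i + r * (b : ℕ) := by nlinarith
    have h2 := Nat.floor_mono h1
    rw [Nat.floor_add_one (add_nonneg (h0 i) (by positivity))] at h2
    exact h2
  have halt (i j : V) (h : G.Adj i j) :
      Alternates (fun a : Fin k => ⌊T i + r * (a : ℕ)⌋₊) (fun a : Fin k => ⌊T j + r * (a : ℕ)⌋₊) ∨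
      Alternates (fun a : Fin k => ⌊T j + r * (a : ℕ)⌋₊) (fun a : Fin k => ⌊T i + r * (a : ℕ)⌋₊) :=
    (hT i j h).imp (fun h' => alternates_floor h'.1 h'.2 (by linarith) (h0 i))
      fun h' => alternates_floor h'.1 h'.2 (by linarith) (h0 j)
  refine ⟨⟨hmono, fun i j h a b => ?_⟩, halt⟩
  rcases halt i j h with h' | h'
  · exact h'.ne (hmono i) a b
  · exact (h'.ne (hmono j) b a).symm

theorem IsTension.exists_nonneg_bounded [Finite V] {r : ℝ} {T : V → ℝ} (hT : IsTension G r T) :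
    ∃ (T' : V → ℝ) (B : ℝ), IsTension G r T' ∧ 0 ≤ B ∧ ∀ i, 0 ≤ T' i ∧ T' i ≤ B := by
  obtain ⟨M, hM⟩ := (Set.finite_range fun i => |T i|).bddAbove
  have hM' (i : V) : |T i| ≤ M := hM ⟨i, rfl⟩
  refine ⟨fun i => T i + |M|, 2 * |M|, fun i j h => ?_, by positivity, fun i => ?_⟩
  · rcases hT i j h with h' | h'
    · exact .inl ⟨by linarith, by linarith⟩
    · exact .inr ⟨by linarith, by linarith⟩
  · have h1 := abs_le.1 (hM' i)
    have h2 := le_abs_self M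
    exact ⟨by linarith, by linarith⟩

theorem IsTension.exists_chiInt_le [Finite V] {r : ℝ} {T : V → ℝ} (hT : IsTension G r T)
    (hr : 1 ≤ r) : ∃ B : ℝ, ∀ k : ℕ, (chiInt G k : ℝ) ≤ B + r * k := by
  obtain ⟨T', B, hT', hB, hTB⟩ := hT.exists_nonneg_bounded
  refine ⟨B + 1, fun k => ?_⟩
  have hc := hT'.isInterleaved hr (fun i => (hTB i).1) k
  have hle : chiInt G k ≤ numColors fun (i : V) (a : Fin k) => ⌊T' i + r * (a : ℕ)⌋₊ :=
    Nat.sInf_le ⟨_, hc, rfl⟩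
  have hsub : (⋃ i, Set.range fun a : Fin k => ⌊T' i + r * (a : ℕ)⌋₊) ⊆
      ((Finset.range (⌊B + r * k⌋₊ + 1) : Finset ℕ) : Set ℕ) := by
    intro x hx
    obtain ⟨i, a, rfl⟩ := Set.mem_iUnion.1 hx
    rw [Finset.mem_coe, Finset.mem_range, Nat.lt_succ_iff]
    refine Nat.floor_mono (add_le_add (hTB i).2 (mul_le_mul_of_nonneg_left ?_ (by linarith)))
    exact_mod_cast a.isLt.le
  have hcard := Set.ncard_le_ncard hsub (Finset.finite_toSet _)
  rw [Set.ncard_coe_finset, Finset.card_range] at hcard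
  have h1 : (chiInt G k : ℝ) ≤ (⌊B + r * k⌋₊ : ℝ) + 1 := by exact_mod_cast hle.trans hcard
  have h2 := Nat.floor_le (a := B + r * k) (by positivity)
  linarith

theorem exists_coloring_chiInt [Finite V] (G : SimpleGraph V) (k : ℕ) :
    ∃ c : V → Fin k → ℕ, IsInterleaved G k c ∧ numColors c = chiInt G k := by
  obtain ⟨r, T, hr, hT⟩ := exists_isTension_of_finite G
  obtain ⟨T', B, hT', -, hTB⟩ := hT.exists_nonneg_bounded
  exact Nat.sInf_mem (s := {n | ∃ c : V → Fin k → ℕ, IsInterleaved G k c ∧ numColors c = n})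
    ⟨_, _, hT'.isInterleaved hr (fun i => (hTB i).1) k, rfl⟩

theorem chiIntStar_le (G : SimpleGraph V) (k : ℕ+) :
    chiIntStar G ≤ (chiInt G k : ℝ) / ((k : ℕ) : ℝ) :=
  ciInf_le ⟨0, by rintro _ ⟨k, rfl⟩; positivity⟩ k

theorem IsTension.chiIntStar_le [Finite V] {r : ℝ} {T : V → ℝ} (hT : IsTension G r T)
    (hr : 1 ≤ r) : chiIntStar G ≤ r := by
  obtain ⟨B, hB⟩ := hT.exists_chiInt_le hr
  have hlim : Filter.Tendsto (fun n : ℕ => B / ((n : ℝ) + 1) + r) Filter.atTop (nhds (0 + r)) := by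
    refine Filter.Tendsto.add_const r ?_
    have := (tendsto_one_div_add_atTop_nhds_zero_nat (𝕜 := ℝ)).const_mul B
    simpa [div_eq_mul_inv] using this
  rw [zero_add] at hlim
  refine ge_of_tendsto' hlim fun n => ?_
  refine (InterleavedColoring.chiIntStar_le G n.succPNat).trans ?_
  have hpos : (0 : ℝ) < (n : ℝ) + 1 := by positivity
  have h := hB (n + 1)
  push_cast at h
  rw [Nat.succPNat_coe, Nat.succ_eq_add_one]
  push_cast
  rw [div_le_iff₀ hpos, add_mul, div_mul_cancel₀ _ hpos.ne']
  exact h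

theorem sum_add_le_of_alternates {k n : ℕ} {x y : Fin k → ℕ} (h : Alternates x y)
    (hy : ∀ a, y a < n) :
    ∑ a, x a + k ≤ ∑ a, y a ∧ ∑ a, y a + k ≤ ∑ a, x a + n := by
  constructor
  · calc ∑ a, x a + k = ∑ a, (x a + 1) := by simp [Finset.sum_add_distrib]
      _ ≤ ∑ a, y a := Finset.sum_le_sum fun a _ => h.1 a
  · cases k with
    | zero => simp
    | succ m =>
      -- Each `y a` is paired with the next `x`; the last `y` is below `n` and the first `x` is at
      -- least `0`.
      have h1 : ∑ a : Fin m, (y a.castSucc + 1) ≤ ∑ a : Fin m, x a.succ :=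
        Finset.sum_le_sum fun a _ => h.2 _ _ (by simp)
      rw [Finset.sum_add_distrib] at h1
      simp only [Finset.sum_const, Finset.card_univ, Fintype.card_fin, smul_eq_mul,
        mul_one] at h1
      have h2 := hy (Fin.last m)
      rw [Fin.sum_univ_castSucc, Fin.sum_univ_succ]
      omega

/-- The average ranks of the colors of the nodes form a tension. -/
theorem IsInterleaved.exists_isTension [Finite V] {k : ℕ} (hk : 0 < k) {c : V → Fin k → ℕ}
    (hc : IsInterleaved G k c) :
    ∃ T : V → ℝ, IsTension G ((numColors c : ℝ) / (k : ℝ)) T := by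
  classical
  set U : Set ℕ := ⋃ v, Set.range (c v) with hU
  have hfin : U.Finite := Set.finite_iUnion fun v => Set.finite_range _
  have hmem (i : V) (a : Fin k) : c i a ∈ U := Set.mem_iUnion.2 ⟨i, a, rfl⟩
  -- The palette may have gaps; ranks close them, so values stay below the number of colors while
  -- the order is kept.
  let rank : ℕ → ℕ := Nat.count (· ∈ U)
  have hrank {x y : ℕ} (hx : x ∈ U) (hxy : x < y) : rank x < rank y :=
    Nat.count_strict_mono hx hxy
  have hlt (x : ℕ) (hx : x ∈ U) : rank x < numColors c := by
    have h := Nat.count_lt_card (p := (· ∈ U)) hfin hx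
    rw [numColors, Set.ncard_eq_toFinset_card _ hfin]
    exact h
  have halt {i j : V} (h : Alternates (c i) (c j)) :
      Alternates (fun a => rank (c i a)) (fun a => rank (c j a)) :=
    ⟨fun a => hrank (hmem i a) (h.1 a), fun a b hab => hrank (hmem j a) (h.2 a b hab)⟩
  have hk' : (0 : ℝ) < k := by exact_mod_cast hk
  have key {i j : V} (h : Alternates (c i) (c j)) :
      ((∑ a, rank (c i a) : ℕ) : ℝ) / k + 1 ≤ ((∑ a, rank (c j a) : ℕ) : ℝ) / k ∧
      ((∑ a, rank (c j a) : ℕ) : ℝ) / k + 1 ≤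
        ((∑ a, rank (c i a) : ℕ) : ℝ) / k + (numColors c : ℝ) / k := by
    obtain ⟨h1, h2⟩ := sum_add_le_of_alternates (halt h) fun a => hlt _ (hmem j a)
    rw [div_add_one hk'.ne', div_add_one hk'.ne', ← add_div]
    exact ⟨div_le_div_of_nonneg_right (by exact_mod_cast h1) hk'.le,
      div_le_div_of_nonneg_right (by exact_mod_cast h2) hk'.le⟩
  exact ⟨fun i => ((∑ a, rank (c i a) : ℕ) : ℝ) / k,
    fun i j h => (hc.alternates i j h).imp key key⟩

theorem exists_isTension_chiInt_div [Finite V] (G : SimpleGraph V) (k : ℕ+) :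
    ∃ T : V → ℝ, IsTension G ((chiInt G k : ℝ) / ((k : ℕ) : ℝ)) T := by
  obtain ⟨c, hc, hn⟩ := exists_coloring_chiInt G k
  rw [← hn]
  exact hc.exists_isTension k.pos

theorem IsTension.two_le {r : ℝ} {T : V → ℝ} (hT : IsTension G r T)
    (hE : G.edgeSet.Nonempty) : 2 ≤ r := by
  obtain ⟨e, he⟩ := hE
  induction e using Sym2.ind with
  | _ i j => rcases hT i j he with h | h <;> linarith

end Colorings

end InterleavedColoring

/-! ### The min-max formula -/

open InterleavedColoring in
theorem theorem4 {V : Type*} [Finite V] (G : SimpleGraph V) (hE : G.edgeSet.Nonempty) :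
    (G.IsAcyclic → InterleavedColoring.chiIntStar G = 2) ∧
    (¬ G.IsAcyclic →
      (∀ ω : InterleavedColoring.AcyclicOrientation G,
        IsGreatest (InterleavedColoring.cycleRatios ω) (InterleavedColoring.maxCycleRatio ω)) ∧
      IsLeast (Set.range fun ω : InterleavedColoring.AcyclicOrientation G =>
        InterleavedColoring.maxCycleRatio ω) (InterleavedColoring.chiIntStar G)) := by
  obtain ⟨_, _, _, hT₀⟩ := exists_isTension_of_finite G
  refine ⟨fun hG => le_antisymm ?_ ?_, fun hG => ⟨fun ω => isGreatest_maxCycleRatio ω hG, ?_⟩⟩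
  · obtain ⟨T, hT⟩ := exists_isTension hT₀.orientation le_rfl fun v κ hκ => absurd hκ (hG κ)
    exact hT.chiIntStar_le one_le_two
  · refine le_ciInf fun k => ?_
    obtain ⟨T, hT⟩ := exists_isTension_chiInt_div G k
    exact hT.two_le hE
  · have hupper (ω : AcyclicOrientation G) : chiIntStar G ≤ maxCycleRatio ω := by
      obtain ⟨⟨v, κ, hκ, hmax⟩, hle⟩ := isGreatest_maxCycleRatio ω hG
      have h2 : 2 ≤ maxCycleRatio ω := hmax ▸ two_le_cycleRatio ω hκ
      obtain ⟨T, hT⟩ := exists_isTension ω h2 fun v κ hκ => hle ⟨v, κ, hκ, rfl⟩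
      exact hT.chiIntStar_le (by linarith)
    have : Nonempty (AcyclicOrientation G) := ⟨hT₀.orientation⟩
    obtain ⟨ω, hω⟩ := Finite.exists_min fun ω : AcyclicOrientation G => maxCycleRatio ω
    refine ⟨⟨ω, le_antisymm (le_ciInf fun k => ?_) (hupper ω)⟩, ?_⟩
    · obtain ⟨T, hT⟩ := exists_isTension_chiInt_div G k
      obtain ⟨v, κ, hκ, hmax⟩ := (isGreatest_maxCycleRatio hT.orientation hG).1
      -- The orientation induced by an optimal `k`-tuple coloring has all ratios at most `chiInt G k
      -- / k`, and `ω` does no worse.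
      exact (hω hT.orientation).trans (hmax ▸ hT.cycleRatio_le hκ)
    · rintro _ ⟨ω', rfl⟩
      exact hupper ω'
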